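/- Let $n,k,t$ be integers with $1\le t\le \min(k,n-k)$, and let $C$ be a set of $k$-element subsets of $[1..n]=\{1,\dots,n\}$. Call $\mathbb{D}=([1..n],C)$ a $t$-design if there is an integer $\lambda\ge 0$ such that every $t$-element subset of $[1..n]$ is contained in exactly $\lambda$ members of $C$. For $w\in\mathrm{GF}(2)^n$ let $\mathrm{wt}(w)$ be its Hamming weight. Let $f_{\mathbb{D}}:\mathrm{GF}(2)^n\to\{0,1\}\subset\mathbb{R}$ be the characteristic function of $\mathbb{D}$, that is, $f_{\mathbb{D}}(x)=1$ if and only if the support $\{i: x_i=1\}$ of $x$ belongs to $C$, and let $$\hat f_{\mathbb{D}}(w)=\sum_{x\in\mathrm{GF}(2)^n} f_{\mathbb{D}}(x)(-1)^{w\cdot x}$$ be its Walsh transform. With $\binom{x}{i}=x(x-1)\cdots(x-i+1)/i!$, define the Krawtchouk and Eberlein polynomials $$P_l(x)=\sum_{j=0}^{l}(-1)^j\binom{x}{j}\binom{n-x}{l-j},\qquad Q_l(x)=\sum_{j=0}^{l}(-1)^j\binom{x}{j}\binom{k-x}{l-j}\binom{n-k-x}{l-j},$$ and put $$v_l=\binom{k}{l}\binom{n-k}{l},\qquad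 \mu_l=\frac{n-2l+1}{n-l+1}\binom{n}{l}.$$ Then $\mathbb{D}$ is a $t$-design if and only if, for every $i\in\{1,\dots,t\}$, $$\sum_{w\in\mathrm{GF}(2)^n}\hat f_{\mathbb{D}}(w)^2\sum_{j=0}^{\min(k,n-k)}\frac{\mu_i}{v_j}\,Q_j(i)\,P_{2j}(\mathrm{wt}(w))=0.$$ -/

import Mathlib

open scoped Nat

namespace SpectralDesign

/-- The set system `B` on the `n`-element point set `Fin n` (standing for `[1..n]`) is a
`t`-`(n, k, lam)` design: all blocks have size `k`, and every `t`-subset of the point set is contained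
in exactly `lam` blocks; here `1 ≤ t ≤ k ≤ n`. -/
structure IsDesign (n t k lam : ℕ) (B : Finset (Finset (Fin n))) : Prop where
  one_le_t : 1 ≤ t
  t_le_k : t ≤ k
  k_le_n : k ≤ n
  card_block : ∀ b ∈ B, b.card = k
  card_containing : ∀ T : Finset (Fin n), T.card = t → (B.filter (fun b => T ⊆ b)).card = lam

/-- `B` is a `t`-design with block size `k`, that is, a `t`-`(n, k, lam)` design for some `lam`. -/
def IsTDesign (n t k : ℕ) (B : Finset (Finset (Fin n))) : Prop :=
  ∃ lam : ℕ, IsDesign n t k lam B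

/-- The support `{i : x i = 1}` of a vector of `GF(2)^n`. -/
def suppt {n : ℕ} (x : Fin n → ZMod 2) : Finset (Fin n) :=
  Finset.univ.filter (fun i => x i = 1)

/-- The Hamming weight of a vector of `GF(2)^n`. -/
def wt {n : ℕ} (x : Fin n → ZMod 2) : ℕ := (suppt x).card

/-- The characteristic Boolean function of a set system: it is `1` at the vectors whose support is a
block, and `0` at all the others. -/
noncomputable def charFun {n : ℕ} (B : Finset (Finset (Fin n))) (x : Fin n → ZMod 2) : ℝ :=
  if suppt x ∈ B then 1 else 0

/-- The Walsh transform `w ↦ ∑ x, f(x) (-1)^(w · x)` of a real-valued function on `GF(2)^n`. -/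
noncomputable def walsh {n : ℕ} (f : (Fin n → ZMod 2) → ℝ) (w : Fin n → ZMod 2) : ℝ :=
  ∑ x : Fin n → ZMod 2, f x * (-1 : ℝ) ^ (w ⬝ᵥ x).val

/-- The generalised binomial coefficient `x (x - 1) ⋯ (x - i + 1) / i!`. -/
noncomputable def binom (x : ℝ) (i : ℕ) : ℝ :=
  (∏ m ∈ Finset.range i, (x - m)) / (i ! : ℝ)

/-- The Krawtchouk polynomial `P_l(x) = ∑_{j=0}^{l} (-1)^j C(x, j) C(n - x, l - j)`. -/
noncomputable def krawtchouk (n l : ℕ) (x : ℝ) : ℝ :=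
  ∑ j ∈ Finset.range (l + 1), (-1 : ℝ) ^ j * binom x j * binom (n - x) (l - j)

/-- The Eberlein polynomial
`Q_l(x) = ∑_{j=0}^{l} (-1)^j C(x, j) C(k - x, l - j) C(n - k - x, l - j)`. -/
noncomputable def eberlein (n k l : ℕ) (x : ℝ) : ℝ :=
  ∑ j ∈ Finset.range (l + 1),
    (-1 : ℝ) ^ j * binom x j * binom (k - x) (l - j) * binom (n - k - x) (l - j)

/-- `v_l = C(k, l) C(n - k, l)`. -/
noncomputable def valency (n k l : ℕ) : ℝ :=
  binom k l * binom ((n : ℝ) - k) l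

/-- `μ_l = (n - 2 l + 1) / (n - l + 1) * C(n, l)`. -/
noncomputable def multiplicity (n l : ℕ) : ℝ :=
  ((n : ℝ) - 2 * l + 1) / ((n : ℝ) - l + 1) * binom n l

end SpectralDesign

/-!
Write `S_i` for the Walsh sum of index `i`. The Krawtchouk polynomial `P_{2j}(wt w)` is the sum of
the characters `u ↦ (-1)^(w · u)` over the vectors `u` of weight `2j` (`krawtchouk_card`), so by
orthogonality of characters the weight `P_{2j}` picks out of the squared Walsh transform `2^n` times
the number of pairs of blocks `b, c` with `|b ∆ c| = 2j`, that is, with `|b \ c| = j`. Hence `S_i` is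
`2^n μ_i` times the sum of `Q_j(i) / v_j` at `j = |b \ c|` over all pairs of blocks
(`sum_walsh_sq_mul_sum_krawtchouk`).

As a function of `j`, the quotient `Q_j(i) / v_j` is a polynomial of degree exactly `i` with explicit
coefficients `hahnCoeff` in the basis `C(j, r)` (`eberlein_div_valency`): it is the Hahn
`₃F₂` form of the Eberlein polynomial, obtained here by induction on `i` from Pascal's rule. So
`S_1, …, S_t` are, up to nonzero factors, triangular combinations of the moments
`M_r = ∑ C(|b \ c|, r)` (`diffMoment`).

On the other side, `C` is a `t`-design exactly when the number of blocks through a `t`-set has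
variance zero, which prescribes the moment `∑ C(|b ∩ c|, t)`. As a `t`-design is an `s`-design for
`s ≤ t`, inclusion–exclusion turns this into `M_r = |C|² C(k, r) C(n - k, r) / C(n, r)` for all
`r ≤ t` (`isTDesign_iff_diffMoment`). By Chu–Vandermonde these values satisfy every equation
`S_i = 0`, `i ≥ 1` (`sum_hahnCoeff_mul_eq_zero`). Since `M_0 = |C|²` always holds and the system is
triangular with nonzero diagonal, they are its only solution, which gives both directions without
the spectral theory of the Johnson scheme.
-/

namespace SpectralDesign

open Finset

/-! ### Binomial identities -/

theorem binom_natCast (x i : ℕ) : binom (x : ℝ) i = (x.choose i : ℝ) := by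
  rw [binom, Nat.cast_choose_eq_descPochhammer_div, descPochhammer_eval_eq_prod_range]

theorem sum_neg_one_pow_choose_mul_choose (m a n : ℕ) (h : a ≤ n) :
    ∑ r ∈ range (m + 1), (-1 : ℝ) ^ r * a.choose r * (n - r).choose (m - r) =
      (n - a).choose m := by
  induction a generalizing m n with
  | zero =>
    rw [sum_range_succ']
    simp
  | succ a ih =>
    obtain ⟨n, rfl⟩ : ∃ n', n = n' + 1 := ⟨n - 1, by omega⟩
    cases m with
    | zero => simp
    | succ m =>
      have h1 := ih (m + 1) (n + 1) (by omega)
      have h2 := ih m n (by omega)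
      have h3 : (n + 1 - a).choose (m + 1) = (n - a).choose m + (n - a).choose (m + 1) := by
        rw [Nat.succ_sub (by omega : a ≤ n), Nat.choose_succ_succ]
      rw [h3, Nat.cast_add] at h1
      have h4 : ∑ r ∈ range (m + 1 + 1),
          (-1 : ℝ) ^ r * (a + 1).choose r * (n + 1 - r).choose (m + 1 - r) =
          ∑ r ∈ range (m + 1 + 1),
            (-1 : ℝ) ^ r * a.choose r * (n + 1 - r).choose (m + 1 - r) -
          ∑ r ∈ range (m + 1), (-1 : ℝ) ^ r * a.choose r * (n - r).choose (m - r) := by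
        rw [sum_range_succ', sum_range_succ' _ (m + 1), add_sub_right_comm, ← sum_sub_distrib]
        simp only [Nat.choose_zero_right, add_left_inj]
        refine sum_congr rfl fun r _ => ?_
        rw [Nat.choose_succ_succ, pow_succ, Nat.add_sub_add_right, Nat.add_sub_add_right]
        push_cast
        ring
      rw [h4, h1, h2, Nat.add_sub_add_right]
      ring

/-- The Chu–Vandermonde sum in terminating form. -/
theorem sum_neg_one_pow_choose_mul_choose_div (m a n : ℕ) (hm : m ≤ n) (ha : a ≤ n) :
    ∑ r ∈ range (m + 1), (-1 : ℝ) ^ r * m.choose r * a.choose r / n.choose r =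
      (n - a).choose m / n.choose m := by
  have hnm : (n.choose m : ℝ) ≠ 0 := by exact_mod_cast (Nat.choose_pos hm).ne'
  rw [← sum_neg_one_pow_choose_mul_choose m a n ha, sum_div]
  refine sum_congr rfl fun r hr => ?_
  have hr : r ≤ m := by simpa [Nat.lt_succ_iff] using hr
  have hnr : (n.choose r : ℝ) ≠ 0 := by exact_mod_cast (Nat.choose_pos (hr.trans hm)).ne'
  have key : (n.choose m : ℝ) * m.choose r = n.choose r * (n - r).choose (m - r) := by
    exact_mod_cast Nat.choose_mul hr
  field_simp
  linear_combination (a.choose r : ℝ) * key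

theorem cast_succ_mul_choose (n r : ℕ) :
    ((r : ℝ) + 1) * n.choose (r + 1) = ((n : ℝ) - r) * n.choose r := by
  rcases le_or_gt r n with h | h
  · have := Nat.choose_succ_right_eq n r
    have h2 : ((n.choose (r + 1) * (r + 1) : ℕ) : ℝ) = (n.choose r * (n - r) : ℕ) := by rw [this]
    push_cast [h] at h2
    linarith
  · simp [Nat.choose_eq_zero_of_lt h, Nat.choose_eq_zero_of_lt (h.trans (Nat.lt_succ_self r))]

theorem cast_succ_mul_succ_choose (n r : ℕ) :
    ((r : ℝ) + 1) * (n + 1).choose (r + 1) = ((n : ℝ) + 1) * n.choose r := by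
  have := Nat.add_one_mul_choose_eq n r
  have h2 : (((n + 1) * n.choose r : ℕ) : ℝ) = ((n + 1).choose (r + 1) * (r + 1) : ℕ) := by
    rw [this]
  push_cast at h2
  linarith

/-! ### Eberlein polynomials in the binomial basis -/

/-- The coefficient of `C(j, r)` in the expansion of `Q_j(i) / v_j`, as a polynomial in `j`, in the
binomial basis, with the parameters `k = p + i` and `n - k = q + i`. -/
noncomputable def hahnCoeff (i p q r : ℕ) : ℝ :=
  (-1) ^ r * i.choose r * (p + q + i + 1).choose r / ((p + i).choose r * (q + i).choose r)

theorem hahnCoeff_zero (i p q : ℕ) : hahnCoeff i p q 0 = 1 := by simp [hahnCoeff]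

theorem hahnCoeff_self_ne_zero (i p q : ℕ) : hahnCoeff i p q i ≠ 0 := by
  have h1 : ((p + q + i + 1).choose i : ℝ) ≠ 0 := by
    exact_mod_cast (Nat.choose_pos (by omega)).ne'
  have h2 : ((p + i).choose i : ℝ) ≠ 0 := by exact_mod_cast (Nat.choose_pos (by omega)).ne'
  have h3 : ((q + i).choose i : ℝ) ≠ 0 := by exact_mod_cast (Nat.choose_pos (by omega)).ne'
  simp [hahnCoeff, h1, h2, h3]

/-- The recurrence that the rule `Q_{j+1}(i+1) = Q_{j+1}(i) - Q_j(i)`, for fixed `p = k - i` and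
`q = n - k - i`, imposes on the coefficients. -/
theorem hahnCoeff_succ (i p q r : ℕ) (hr : r ≤ i) :
    ((p : ℝ) + i + 1) * (q + i + 1) * hahnCoeff (i + 1) p q (r + 1) =
      ((p : ℝ) + i - r) * (q + i - r) * hahnCoeff i p q (r + 1) -
        ((p : ℝ) + q + 2 * i + 2 - r) * (r + 1) * hahnCoeff i p q r := by
  have hu : ((p + i).choose r : ℝ) ≠ 0 := by exact_mod_cast (Nat.choose_pos (by omega)).ne'
  have hv : ((q + i).choose r : ℝ) ≠ 0 := by exact_mod_cast (Nat.choose_pos (by omega)).ne'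
  have hr1 : (r : ℝ) + 1 ≠ 0 := by positivity
  have e1 (n : ℕ) : (n.choose (r + 1) : ℝ) = ((n : ℝ) - r) * n.choose r / (r + 1) := by
    rw [← cast_succ_mul_choose]; field_simp
  have e2 (n : ℕ) : ((n + 1).choose (r + 1) : ℝ) = ((n : ℝ) + 1) * n.choose r / (r + 1) := by
    rw [← cast_succ_mul_succ_choose]; field_simp
  have hp : (p : ℝ) + i + 1 ≠ 0 := by positivity
  have hq : (q : ℝ) + i + 1 ≠ 0 := by positivity
  have hL : ((p : ℝ) + i + 1) * (q + i + 1) * hahnCoeff (i + 1) p q (r + 1) =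
      -((-1) ^ r * (i + 1) * (p + q + i + 2) * i.choose r * (p + q + i + 1).choose r /
        ((p + i).choose r * (q + i).choose r)) := by
    unfold hahnCoeff
    rw [← add_assoc, ← add_assoc, ← add_assoc, e2, e2, e2, e2]
    push_cast
    field_simp
    ring
  have hR : ((p : ℝ) + i - r) * (q + i - r) * hahnCoeff i p q (r + 1) =
      -((-1) ^ r * (i - r) * (p + q + i + 1 - r) * i.choose r * (p + q + i + 1).choose r /
        ((p + i).choose r * (q + i).choose r)) := by
    rcases hr.eq_or_lt with rfl | hlt
    · simp [hahnCoeff]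
    · have hlt' : (r : ℝ) < i := by exact_mod_cast hlt
      have hp' : (p : ℝ) + i - r ≠ 0 := by
        have : (0 : ℝ) ≤ p := by positivity
        intro h; linarith
      have hq' : (q : ℝ) + i - r ≠ 0 := by
        have : (0 : ℝ) ≤ q := by positivity
        intro h; linarith
      unfold hahnCoeff
      rw [e1, e1, e1, e1]
      push_cast
      field_simp
      ring
  rw [hL, hR, hahnCoeff]
  field_simp
  ring

/-- The rule `Q_{j+1}(i+1) = Q_{j+1}(i) - Q_j(i)` for the sum that defines the Eberlein polynomial
at an integer `i`, where `p = k - i` and `q = n - k - i` are kept fixed; it is Pascal's rule for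
`C(i + 1, l)`. -/
theorem eberlein_sum_succ (i p q j : ℕ) :
    ∑ l ∈ range (j + 2),
        (-1 : ℝ) ^ l * (i + 1).choose l * p.choose (j + 1 - l) * q.choose (j + 1 - l) =
      ∑ l ∈ range (j + 2),
        (-1 : ℝ) ^ l * i.choose l * p.choose (j + 1 - l) * q.choose (j + 1 - l) -
      ∑ l ∈ range (j + 1),
        (-1 : ℝ) ^ l * i.choose l * p.choose (j - l) * q.choose (j - l) := by
  rw [sum_range_succ', sum_range_succ' _ (j + 1), add_sub_right_comm, ← sum_sub_distrib]
  simp only [Nat.choose_zero_right, add_left_inj]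
  refine sum_congr rfl fun l _ => ?_
  rw [Nat.choose_succ_succ, pow_succ, Nat.add_sub_add_right]
  push_cast
  ring

/-- The expansion in the binomial basis satisfies the same rule as the Eberlein sums. -/
theorem hahnCoeff_sum_succ (i p q j : ℕ) :
    ((p + i + 1).choose (j + 1) : ℝ) * (q + i + 1).choose (j + 1) *
        ∑ r ∈ range (i + 2), hahnCoeff (i + 1) p q r * (j + 1).choose r =
      (p + i).choose (j + 1) * (q + i).choose (j + 1) *
        ∑ r ∈ range (i + 1), hahnCoeff i p q r * (j + 1).choose r -
      (p + i).choose j * (q + i).choose j *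
        ∑ r ∈ range (i + 1), hahnCoeff i p q r * j.choose r := by
  have hp : (p : ℝ) + i + 1 ≠ 0 := by positivity
  have hq : (q : ℝ) + i + 1 ≠ 0 := by positivity
  -- everything is expressed through the binomial coefficients with lower index `j + 1`
  have d1 (n : ℕ) : ((n : ℝ) + 1) * n.choose j = (j + 1) * (n + 1).choose (j + 1) :=
    (cast_succ_mul_succ_choose n j).symm
  have d2 (n : ℕ) : ((n : ℝ) + 1) * n.choose (j + 1) = (n - j) * (n + 1).choose (j + 1) := by
    have h1 := d1 n
    have h2 : ((n + 1).choose (j + 1) : ℝ) = n.choose j + n.choose (j + 1) := by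
      rw [Nat.choose_succ_succ]; push_cast; ring
    linear_combination (-(n : ℝ) - 1) * h2 - h1
  have d3 (r : ℕ) : ((j : ℝ) + 1) * j.choose r = (j + 1 - r) * (j + 1).choose r := by
    cases r with
    | zero => simp
    | succ r =>
      have h2 : ((j + 1).choose (r + 1) : ℝ) = j.choose r + j.choose (r + 1) := by
        rw [Nat.choose_succ_succ]; push_cast; ring
      have h3 := cast_succ_mul_succ_choose j r
      push_cast
      linear_combination (-(j : ℝ) - 1) * h2 + h3
  have d4 (r : ℕ) : ((j : ℝ) + 1 - r) * (j + 1).choose r = (r + 1) * (j + 1).choose (r + 1) := by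
    have := cast_succ_mul_choose (j + 1) r
    push_cast at this
    linarith
  have main : ((p : ℝ) + i + 1) * (q + i + 1) *
      ∑ r ∈ range (i + 2), hahnCoeff (i + 1) p q r * (j + 1).choose r =
      ∑ r ∈ range (i + 1), hahnCoeff i p q r *
        (((p : ℝ) + i - j) * (q + i - j) - (j + 1) * (j + 1 - r)) * (j + 1).choose r := by
    have t1 : ∑ r ∈ range (i + 1), hahnCoeff i p q r *
        (((p : ℝ) + i - j) * (q + i - j) - (j + 1) * (j + 1 - r)) * (j + 1).choose r =
        ∑ r ∈ range (i + 2), ((p : ℝ) + i + 1 - r) * (q + i + 1 - r) *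
          hahnCoeff i p q r * (j + 1).choose r -
        ∑ r ∈ range (i + 1), ((p : ℝ) + q + 2 * i + 2 - r) * (r + 1) *
          hahnCoeff i p q r * (j + 1).choose (r + 1) := by
      have hz : hahnCoeff i p q (i + 1) = 0 := by simp [hahnCoeff]
      rw [sum_range_succ _ (i + 1), hz, mul_zero, zero_mul, add_zero, ← sum_sub_distrib]
      refine sum_congr rfl fun r _ => ?_
      linear_combination
        (-hahnCoeff i p q r * ((p : ℝ) + q + 2 * i + 2 - r)) * d4 r
    rw [t1, sum_range_succ', sum_range_succ' _ (i + 1), hahnCoeff_zero, hahnCoeff_zero, mul_add,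
      add_sub_right_comm, ← sum_sub_distrib, mul_sum]
    congr 1
    · refine sum_congr rfl fun r hr => ?_
      have h := hahnCoeff_succ i p q r (by simpa [Nat.lt_succ_iff] using hr)
      push_cast
      linear_combination ((j + 1).choose (r + 1) : ℝ) * h
    · simp
  have a1 := d1 (p + i)
  have a2 := d1 (q + i)
  have b1 := d2 (p + i)
  have b2 := d2 (q + i)
  push_cast at a1 a2 b1 b2
  have s1 : ((j : ℝ) + 1) * ∑ r ∈ range (i + 1), hahnCoeff i p q r * j.choose r =
      ∑ r ∈ range (i + 1), hahnCoeff i p q r * (j + 1 - r) * (j + 1).choose r := by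
    rw [mul_sum]
    refine sum_congr rfl fun r _ => ?_
    linear_combination hahnCoeff i p q r * d3 r
  have s2 : ∑ r ∈ range (i + 1), hahnCoeff i p q r *
        (((p : ℝ) + i - j) * (q + i - j) - (j + 1) * (j + 1 - r)) * (j + 1).choose r =
      ((p : ℝ) + i - j) * (q + i - j) *
        ∑ r ∈ range (i + 1), hahnCoeff i p q r * (j + 1).choose r -
      (j + 1) * ((j + 1) * ∑ r ∈ range (i + 1), hahnCoeff i p q r * j.choose r) := by
    rw [s1, mul_sum, mul_sum, ← sum_sub_distrib]
    refine sum_congr rfl fun r _ => ?_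
    ring
  rw [s2] at main
  set A := ∑ r ∈ range (i + 2), hahnCoeff (i + 1) p q r * ((j + 1).choose r : ℝ)
  set B := ∑ r ∈ range (i + 1), hahnCoeff i p q r * ((j + 1).choose r : ℝ)
  set D := ∑ r ∈ range (i + 1), hahnCoeff i p q r * (j.choose r : ℝ)
  set U := ((p + i + 1).choose (j + 1) : ℝ)
  set V := ((q + i + 1).choose (j + 1) : ℝ)
  refine mul_left_cancel₀ (mul_ne_zero hp hq) ?_
  have b3 : (((p : ℝ) + i + 1) * (p + i).choose (j + 1)) *
      ((q + i + 1) * (q + i).choose (j + 1)) =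
      ((p + i - j) * U) * ((q + i - j) * V) := by rw [b1, b2]
  have a3 : (((p : ℝ) + i + 1) * (p + i).choose j) * ((q + i + 1) * (q + i).choose j) =
      ((j + 1) * U) * ((j + 1) * V) := by rw [a1, a2]
  linear_combination U * V * main - B * b3 + D * a3

theorem eberlein_sum_eq (i p q j : ℕ) :
    ∑ l ∈ range (j + 1), (-1 : ℝ) ^ l * i.choose l * p.choose (j - l) * q.choose (j - l) =
      (p + i).choose j * (q + i).choose j *
        ∑ r ∈ range (i + 1), hahnCoeff i p q r * j.choose r := by
  induction i generalizing j with
  | zero =>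
    rw [sum_range_succ']
    simp [hahnCoeff_zero]
  | succ i ih =>
    cases j with
    | zero =>
      rw [sum_range_succ' _ (i + 1)]
      simp [hahnCoeff_zero]
    | succ j =>
      rw [eberlein_sum_succ, ih, ih]
      exact (hahnCoeff_sum_succ i p q j).symm

/-- `Q_j(i) / v_j` is a polynomial of degree `i` in `j`. -/
theorem eberlein_div_valency (n k i j : ℕ) (hk : i ≤ k) (hn : i + k ≤ n) (hjk : j ≤ k)
    (hjn : j + k ≤ n) :
    eberlein n k j i / valency n k j =
      ∑ r ∈ range (i + 1), hahnCoeff i (k - i) (n - k - i) r * j.choose r := by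
  obtain ⟨p, rfl⟩ : ∃ p, k = p + i := ⟨k - i, by omega⟩
  obtain ⟨q, rfl⟩ : ∃ q, n = q + i + (p + i) := ⟨n - (p + i) - i, by omega⟩
  have e1 : ((p + i : ℕ) : ℝ) - i = (p : ℕ) := by push_cast; ring
  have e2 : ((q + i + (p + i) : ℕ) : ℝ) - (p + i : ℕ) = (q + i : ℕ) := by push_cast; ring
  have e3 : ((q + i : ℕ) : ℝ) - i = (q : ℕ) := by push_cast; ring
  have h : valency (q + i + (p + i)) (p + i) j = (p + i).choose j * (q + i).choose j := by
    rw [valency, e2, binom_natCast, binom_natCast]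
  have h1 : ((p + i).choose j : ℝ) ≠ 0 := by exact_mod_cast (Nat.choose_pos hjk).ne'
  have h2 : ((q + i).choose j : ℝ) ≠ 0 := by
    exact_mod_cast (Nat.choose_pos (by omega)).ne'
  rw [h, div_eq_iff (mul_ne_zero h1 h2), eberlein, e2, e1, e3]
  simp only [binom_natCast, Nat.add_sub_cancel]
  rw [eberlein_sum_eq, mul_comm]

/-- The moments of a design solve the equations for `i ≥ 1`: the sum is a Chu–Vandermonde sum with
value `C(i - 1, i) / C(n, i) = 0`. -/
theorem sum_hahnCoeff_mul_eq_zero (n k i : ℕ) (hi : 1 ≤ i) (hk : i ≤ k) (hn : i + k ≤ n) :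
    ∑ r ∈ range (i + 1), hahnCoeff i (k - i) (n - k - i) r *
      ((k.choose r : ℝ) * (n - k).choose r / n.choose r) = 0 := by
  have h := sum_neg_one_pow_choose_mul_choose_div i (n + 1 - i) n (by omega) (by omega)
  rw [Nat.choose_eq_zero_of_lt (by omega : n - (n + 1 - i) < i), Nat.cast_zero, zero_div] at h
  rw [← h]
  refine sum_congr rfl fun r hr => ?_
  have hr : r ≤ i := by simpa [Nat.lt_succ_iff] using hr
  have h1 : (k.choose r : ℝ) ≠ 0 := by exact_mod_cast (Nat.choose_pos (by omega)).ne'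
  have h2 : ((n - k).choose r : ℝ) ≠ 0 := by exact_mod_cast (Nat.choose_pos (by omega)).ne'
  rw [hahnCoeff, Nat.sub_add_cancel hk, Nat.sub_add_cancel (by omega : i ≤ n - k),
    show k - i + (n - k - i) + i + 1 = n + 1 - i by omega]
  field_simp

/-! ### The Walsh transform and the distance distribution -/

/-- A vector of `GF(2)^n` is determined by its support. -/
def supptEquiv (n : ℕ) : (Fin n → ZMod 2) ≃ Finset (Fin n) where
  toFun := suppt
  invFun b i := if i ∈ b then 1 else 0
  left_inv x := by
    funext i
    have h : ∀ a : ZMod 2, (if a = 1 then (1 : ZMod 2) else 0) = a := by decide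
    simpa [suppt] using h (x i)
  right_inv b := by
    ext i
    simp [suppt]

/-- The `±1`-valued indicator of a set: `-1` on `b` and `1` elsewhere. -/
def signFn {n : ℕ} (b : Finset (Fin n)) (i : Fin n) : ℝ := if i ∈ b then -1 else 1

theorem prod_signFn_comm {n : ℕ} (b c : Finset (Fin n)) :
    ∏ i ∈ c, signFn b i = ∏ i ∈ b, signFn c i := by
  simp only [signFn, prod_ite_mem, inter_comm]

theorem neg_one_pow_dotProduct {n : ℕ} (w x : Fin n → ZMod 2) :
    (-1 : ℝ) ^ (w ⬝ᵥ x).val = ∏ i ∈ suppt w, signFn (suppt x) i := by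
  have h01 : ∀ a : ZMod 2, a = 0 ∨ a = 1 := by decide
  have h11 : (1 + 1 : ZMod 2) = 0 := by decide
  have hadd : ∀ a b : ZMod 2, (-1 : ℝ) ^ (a + b).val = (-1) ^ a.val * (-1) ^ b.val := by
    intro a b
    rcases h01 a with rfl | rfl <;> rcases h01 b with rfl | rfl <;> simp [h11, ZMod.val_one]
  have hmul : ∀ a b : ZMod 2, (-1 : ℝ) ^ (a * b).val =
      if a = 1 then (if b = 1 then -1 else 1) else 1 := by
    intro a b
    rcases h01 a with rfl | rfl <;> rcases h01 b with rfl | rfl <;> simp [ZMod.val_one]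
  have hsum : ∀ (s : Finset (Fin n)) (f : Fin n → ZMod 2),
      (-1 : ℝ) ^ (∑ i ∈ s, f i).val = ∏ i ∈ s, (-1 : ℝ) ^ (f i).val := by
    intro s f
    induction s using Finset.induction_on with
    | empty => simp
    | insert a s ha ih => rw [sum_insert ha, prod_insert ha, hadd, ih]
  rw [dotProduct, hsum, suppt, prod_filter]
  refine prod_congr rfl fun i _ => ?_
  rw [hmul]
  simp [signFn, suppt]

theorem walsh_charFun {n : ℕ} (C : Finset (Finset (Fin n))) (w : Fin n → ZMod 2) :
    walsh (charFun C) w = ∑ b ∈ C, ∏ i ∈ suppt w, signFn b i := by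
  have h := (supptEquiv n).sum_comp
    (fun b => (if b ∈ C then (1 : ℝ) else 0) * ∏ i ∈ suppt w, signFn b i)
  simp only [ite_mul, one_mul, zero_mul, sum_ite_mem, univ_inter] at h
  rw [← h, walsh]
  refine sum_congr rfl fun x _ => ?_
  rw [neg_one_pow_dotProduct, charFun, ite_mul, one_mul, zero_mul]
  rfl

/-- The Krawtchouk polynomial is the character sum over a sphere; both sides are the coefficient of
`X ^ l` in `(1 - X) ^ |b| (1 + X) ^ (n - |b|)`. -/
theorem krawtchouk_card {n : ℕ} (l : ℕ) (b : Finset (Fin n)) :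
    krawtchouk n l b.card = ∑ u : Finset (Fin n) with u.card = l, ∏ i ∈ u, signFn b i := by
  have hle : b.card ≤ n := by simpa using card_le_univ b
  have hP : ∏ i : Fin n, (1 + Polynomial.C (signFn b i) * Polynomial.X) =
      (1 + Polynomial.C (-1 : ℝ) * Polynomial.X) ^ b.card *
        (1 + Polynomial.X) ^ (n - b.card) := by
    rw [← prod_mul_prod_compl b]
    congr 1
    · rw [← prod_const]
      exact prod_congr rfl fun i hi => by simp [signFn, hi]
    · rw [show n - b.card = bᶜ.card by simp [card_compl], ← prod_const]
      exact prod_congr rfl fun i hi => by simp [signFn, mem_compl.mp hi]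
  have hneg (m j : ℕ) : ((1 + Polynomial.C (-1 : ℝ) * Polynomial.X) ^ m).coeff j =
      (-1 : ℝ) ^ j * m.choose j := by
    have : (1 + Polynomial.C (-1 : ℝ) * Polynomial.X) ^ m =
        ((1 + Polynomial.X) ^ m).comp (Polynomial.C (-1 : ℝ) * Polynomial.X) := by simp
    rw [this, Polynomial.comp_C_mul_X_coeff, Polynomial.coeff_one_add_X_pow, mul_comm]
  have h := congrArg (fun P => P.coeff l) hP
  simp only [Polynomial.coeff_mul, hneg, Polynomial.coeff_one_add_X_pow] at h
  rw [Nat.sum_antidiagonal_eq_sum_range_succ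
    (fun i j => (-1 : ℝ) ^ i * b.card.choose i * (n - b.card).choose j)] at h
  simp only [krawtchouk, ← Nat.cast_sub hle, binom_natCast]
  rw [← h, prod_one_add, Polynomial.finsetSum_coeff, powerset_univ, sum_filter]
  refine sum_congr rfl fun u _ => ?_
  rw [prod_mul_distrib, prod_const, ← map_prod, Polynomial.coeff_C_mul_X_pow]
  simp only [eq_comm]

/-- Orthogonality of the characters of `GF(2)^n`. -/
theorem sum_prod_signFn {n : ℕ} (b c u : Finset (Fin n)) :
    ∑ w : Finset (Fin n), (∏ i ∈ w, signFn b i) * (∏ i ∈ w, signFn c i) *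
      ∏ i ∈ w, signFn u i = if symmDiff b c = u then 2 ^ n else 0 := by
  simp only [← prod_mul_distrib]
  rw [← powerset_univ, ← prod_one_add]
  split_ifs with h
  · rw [show (2 : ℝ) ^ n = ∏ _i : Fin n, 2 by simp]
    refine prod_congr rfl fun i _ => ?_
    subst h
    by_cases hb : i ∈ b <;> by_cases hc : i ∈ c <;>
      norm_num [signFn, mem_symmDiff, hb, hc]
  · obtain ⟨i, hi⟩ : ∃ i, ¬(i ∈ symmDiff b c ↔ i ∈ u) := by
      by_contra! hcon
      exact h (Finset.ext hcon)
    refine prod_eq_zero (mem_univ i) ?_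
    revert hi
    by_cases hb : i ∈ b <;> by_cases hc : i ∈ c <;> by_cases hu : i ∈ u <;>
      norm_num [signFn, mem_symmDiff, hb, hc, hu]

/-- The squared Walsh transform, weighted by `P_l`, counts pairs of blocks at Hamming distance `l`. -/
theorem sum_walsh_sq_mul_krawtchouk {n : ℕ} (C : Finset (Finset (Fin n))) (l : ℕ) :
    ∑ w : Fin n → ZMod 2, walsh (charFun C) w ^ 2 * krawtchouk n l (wt w) =
      2 ^ n * ∑ b ∈ C, ∑ c ∈ C, if (symmDiff b c).card = l then (1 : ℝ) else 0 := by
  have h := (supptEquiv n).sum_comp (fun w => (∑ b ∈ C, ∏ i ∈ w, signFn b i) ^ 2 *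
    ∑ u : Finset (Fin n) with u.card = l, ∏ i ∈ w, signFn u i)
  calc _ = _ := by
        refine sum_congr rfl fun w _ => ?_
        rw [walsh_charFun, wt, krawtchouk_card]
        simp only [prod_signFn_comm (suppt w)]
        rfl
    _ = _ := h
    _ = ∑ b ∈ C, ∑ c ∈ C, ∑ u : Finset (Fin n) with u.card = l,
          ∑ w : Finset (Fin n), (∏ i ∈ w, signFn b i) * (∏ i ∈ w, signFn c i) *
            ∏ i ∈ w, signFn u i := by
        have hexp (w : Finset (Fin n)) : (∑ b ∈ C, ∏ i ∈ w, signFn b i) ^ 2 *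
            ∑ u : Finset (Fin n) with u.card = l, ∏ i ∈ w, signFn u i =
            ∑ b ∈ C, ∑ c ∈ C, ∑ u : Finset (Fin n) with u.card = l,
              (∏ i ∈ w, signFn b i) * (∏ i ∈ w, signFn c i) * ∏ i ∈ w, signFn u i := by
          simp only [sq, sum_mul_sum C C]
          simp only [sum_mul]
          simp only [mul_sum]
        simp only [hexp]
        rw [sum_comm]
        refine sum_congr rfl fun b _ => ?_
        rw [sum_comm]
        refine sum_congr rfl fun c _ => ?_
        rw [sum_comm]
    _ = _ := by
        simp only [sum_prod_signFn, mul_sum]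
        refine sum_congr rfl fun b _ => sum_congr rfl fun c _ => ?_
        rw [sum_ite_eq]
        simp

theorem card_symmDiff_of_card_eq {n : ℕ} {b c : Finset (Fin n)} (h : b.card = c.card) :
    (symmDiff b c).card = 2 * (b \ c).card := by
  rw [symmDiff_def, sup_eq_union, card_union_of_disjoint disjoint_sdiff_sdiff,
    card_sdiff_comm h.symm, two_mul]

/-- For blocks of constant size, a combination of even Krawtchouk polynomials integrates to a sum
over pairs of blocks of a function of `|b \ c|`. -/
theorem sum_walsh_sq_mul_sum_krawtchouk {n k : ℕ} {C : Finset (Finset (Fin n))}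
    (hC : ∀ b ∈ C, b.card = k) (g : ℕ → ℝ) :
    ∑ w : Fin n → ZMod 2, walsh (charFun C) w ^ 2 *
        ∑ j ∈ range (min k (n - k) + 1), g j * krawtchouk n (2 * j) (wt w) =
      2 ^ n * ∑ b ∈ C, ∑ c ∈ C, g (b \ c).card := by
  have hswap : ∑ w : Fin n → ZMod 2, walsh (charFun C) w ^ 2 *
        ∑ j ∈ range (min k (n - k) + 1), g j * krawtchouk n (2 * j) (wt w) =
      2 ^ n * ∑ j ∈ range (min k (n - k) + 1), ∑ b ∈ C, ∑ c ∈ C,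
        g j * if (symmDiff b c).card = 2 * j then (1 : ℝ) else 0 := by
    simp only [mul_sum (range _)]
    rw [sum_comm]
    refine sum_congr rfl fun j _ => ?_
    simp only [← mul_sum]
    rw [mul_left_comm, ← sum_walsh_sq_mul_krawtchouk, mul_sum]
    exact sum_congr rfl fun w _ => by ring
  rw [hswap]
  congr 1
  rw [sum_comm]
  refine sum_congr rfl fun b hb => ?_
  rw [sum_comm]
  refine sum_congr rfl fun c hc => ?_
  rw [card_symmDiff_of_card_eq ((hC b hb).trans (hC c hc).symm)]
  have hk : (b \ c).card ≤ k := (card_le_card sdiff_subset).trans (hC b hb).le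
  have hn : (b \ c).card ≤ n - k := by
    have h1 : (b \ c).card ≤ cᶜ.card := card_le_card fun i hi => by simp_all
    simpa [card_compl, hC c hc] using h1
  rw [sum_eq_single_of_mem (b \ c).card (by rw [mem_range]; omega)]
  · simp
  · intro j _ hj
    rw [if_neg (by omega), mul_zero]

/-! ### Moments of the intersection numbers and designs -/

/-- The number of blocks that contain `T`. -/
def blockCount {n : ℕ} (C : Finset (Finset (Fin n))) (T : Finset (Fin n)) : ℕ :=
  (C.filter (fun b => T ⊆ b)).card

/-- The binomial moment `∑ C(|b ∩ c|, s)` over all pairs of blocks. -/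
def interMoment {n : ℕ} (C : Finset (Finset (Fin n))) (s : ℕ) : ℝ :=
  ∑ b ∈ C, ∑ c ∈ C, ((b ∩ c).card.choose s : ℝ)

/-- The binomial moment `∑ C(|b \ c|, r)` over all pairs of blocks. -/
def diffMoment {n : ℕ} (C : Finset (Finset (Fin n))) (r : ℕ) : ℝ :=
  ∑ b ∈ C, ∑ c ∈ C, ((b \ c).card.choose r : ℝ)

theorem card_powersetCard_subset {n : ℕ} (b : Finset (Fin n)) (s : ℕ) :
    ∑ T ∈ powersetCard s (univ : Finset (Fin n)), (if T ⊆ b then (1 : ℝ) else 0) =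
      b.card.choose s := by
  rw [sum_boole, ← card_powersetCard]
  congr 2
  ext T
  simp [mem_powersetCard, and_comm]

theorem cast_blockCount {n : ℕ} (C : Finset (Finset (Fin n))) (T : Finset (Fin n)) :
    (blockCount C T : ℝ) = ∑ b ∈ C, if T ⊆ b then 1 else 0 := by
  rw [blockCount, sum_boole]

theorem sum_blockCount {n k : ℕ} {C : Finset (Finset (Fin n))} (hC : ∀ b ∈ C, b.card = k)
    (s : ℕ) :
    ∑ T ∈ powersetCard s (univ : Finset (Fin n)), (blockCount C T : ℝ) =
      C.card * k.choose s := by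
  simp only [cast_blockCount]
  rw [sum_comm]
  simp only [card_powersetCard_subset]
  rw [sum_congr rfl fun b hb => by rw [hC b hb]]
  simp

theorem sum_blockCount_sq {n : ℕ} (C : Finset (Finset (Fin n))) (s : ℕ) :
    ∑ T ∈ powersetCard s (univ : Finset (Fin n)), (blockCount C T : ℝ) ^ 2 =
      interMoment C s := by
  simp only [cast_blockCount, sq, sum_mul_sum]
  rw [sum_comm]
  refine sum_congr rfl fun b _ => ?_
  rw [sum_comm]
  refine sum_congr rfl fun c _ => ?_
  rw [← card_powersetCard_subset]
  refine sum_congr rfl fun T _ => ?_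
  by_cases h1 : T ⊆ b <;> by_cases h2 : T ⊆ c <;> simp [subset_inter_iff, h1, h2]

/-- The block counts of `s`-sets are constant exactly when their variance vanishes. -/
theorem exists_blockCount_eq_iff {n k s : ℕ} {C : Finset (Finset (Fin n))}
    (hC : ∀ b ∈ C, b.card = k) (hs : s ≤ n) :
    (∃ lam : ℕ, ∀ T : Finset (Fin n), T.card = s → blockCount C T = lam) ↔
      interMoment C s = (C.card * k.choose s) ^ 2 / n.choose s := by
  have hn : (n.choose s : ℝ) ≠ 0 := by exact_mod_cast (Nat.choose_pos hs).ne'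
  have hcard : ((powersetCard s (univ : Finset (Fin n))).card : ℝ) = n.choose s := by simp
  rw [← sum_blockCount hC s, ← sum_blockCount_sq]
  constructor
  · rintro ⟨lam, h⟩
    have h' : ∀ T ∈ powersetCard s (univ : Finset (Fin n)), blockCount C T = lam :=
      fun T hT => h T (mem_powersetCard.mp hT).2
    have h1 : ∑ T ∈ powersetCard s (univ : Finset (Fin n)), (blockCount C T : ℝ) =
        ∑ _T ∈ powersetCard s (univ : Finset (Fin n)), (lam : ℝ) :=
      sum_congr rfl fun T hT => by rw [h' T hT]
    have h2 : ∑ T ∈ powersetCard s (univ : Finset (Fin n)), (blockCount C T : ℝ) ^ 2 =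
        ∑ _T ∈ powersetCard s (univ : Finset (Fin n)), (lam : ℝ) ^ 2 :=
      sum_congr rfl fun T hT => by rw [h' T hT]
    rw [h1, h2, sum_const, sum_const, nsmul_eq_mul, nsmul_eq_mul, hcard]
    field_simp
  · intro h
    set m : ℝ := (∑ T ∈ powersetCard s (univ : Finset (Fin n)), (blockCount C T : ℝ)) /
      n.choose s with hm
    have hsum : ∑ T ∈ powersetCard s (univ : Finset (Fin n)), (blockCount C T : ℝ) =
        n.choose s * m := by rw [hm]; field_simp
    have hvar : ∑ T ∈ powersetCard s (univ : Finset (Fin n)), ((blockCount C T : ℝ) - m) ^ 2 =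
        0 := by
      simp only [sub_sq, sum_add_distrib, sum_sub_distrib, sum_const, nsmul_eq_mul, hcard,
        ← sum_mul, ← mul_sum, h, hsum]
      field_simp
      ring
    rw [sum_eq_zero_iff_of_nonneg fun T _ => sq_nonneg _] at hvar
    have hconst : ∀ T : Finset (Fin n), T.card = s → (blockCount C T : ℝ) = m := fun T hT =>
      sub_eq_zero.mp (pow_eq_zero_iff two_ne_zero |>.mp
        (hvar T (mem_powersetCard.mpr ⟨subset_univ T, hT⟩)))
    obtain ⟨T₀, -, hT₀⟩ := exists_subset_card_eq (s := (univ : Finset (Fin n))) (n := s)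
      (by simpa using hs)
    refine ⟨blockCount C T₀, fun T hT => ?_⟩
    exact_mod_cast (hconst T hT).trans (hconst T₀ hT₀).symm

/-- A point `x` outside `S` and a block through `insert x S` are counted in two ways. -/
theorem sum_blockCount_insert {n k : ℕ} {C : Finset (Finset (Fin n))}
    (hC : ∀ b ∈ C, b.card = k) (S : Finset (Fin n)) :
    ∑ x ∈ Sᶜ, blockCount C (insert x S) = blockCount C S * (k - S.card) := by
  simp only [blockCount, card_filter]
  rw [sum_comm, sum_mul]
  refine sum_congr rfl fun b hb => ?_
  by_cases hS : S ⊆ b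
  · simp only [insert_subset_iff, hS, and_true, if_true, one_mul]
    rw [← card_filter, ← hC b hb, ← card_sdiff_of_subset hS]
    congr 1
    ext x
    simp [and_comm]
  · simp [insert_subset_iff, hS]

theorem exists_blockCount_eq_of_succ {n k s : ℕ} {C : Finset (Finset (Fin n))}
    (hC : ∀ b ∈ C, b.card = k) (hs : s < k)
    (h : ∃ lam : ℕ, ∀ T : Finset (Fin n), T.card = s + 1 → blockCount C T = lam) :
    ∃ lam : ℕ, ∀ T : Finset (Fin n), T.card = s → blockCount C T = lam := by
  obtain ⟨lam, h⟩ := h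
  refine ⟨(n - s) * lam / (k - s), fun S hS => ?_⟩
  have h1 := sum_blockCount_insert hC S
  rw [sum_congr rfl fun x hx => h (insert x S) (by
    rw [card_insert_of_notMem (mem_compl.mp hx), hS]), sum_const, card_compl, hS,
    Fintype.card_fin, smul_eq_mul] at h1
  rw [h1, Nat.mul_div_cancel _ (by omega)]

theorem exists_blockCount_eq_of_le {n k s t : ℕ} {C : Finset (Finset (Fin n))}
    (hC : ∀ b ∈ C, b.card = k) (hst : s ≤ t) (htk : t ≤ k)
    (h : ∃ lam : ℕ, ∀ T : Finset (Fin n), T.card = t → blockCount C T = lam) :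
    ∃ lam : ℕ, ∀ T : Finset (Fin n), T.card = s → blockCount C T = lam := by
  induction t, hst using Nat.le_induction with
  | base => exact h
  | succ t hst ih => exact ih (by omega) (exists_blockCount_eq_of_succ hC (by omega) h)

/-- The two families of moments determine each other through inclusion–exclusion. -/
theorem diffMoment_eq_sum {n k : ℕ} {C : Finset (Finset (Fin n))} (hC : ∀ b ∈ C, b.card = k)
    (r : ℕ) :
    diffMoment C r =
      ∑ s ∈ range (r + 1), (-1) ^ s * (k - s).choose (r - s) * interMoment C s := by
  simp only [diffMoment, interMoment, mul_sum]
  rw [sum_comm (s := range _)]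
  refine sum_congr rfl fun b hb => ?_
  rw [sum_comm (s := range _)]
  refine sum_congr rfl fun c _ => ?_
  rw [card_sdiff, inter_comm c b, hC b hb, ← sum_neg_one_pow_choose_mul_choose _ _ _
    (by rw [← hC b hb]; exact card_le_card inter_subset_left)]
  exact sum_congr rfl fun s _ => by ring

theorem interMoment_eq_sum {n k : ℕ} {C : Finset (Finset (Fin n))} (hC : ∀ b ∈ C, b.card = k)
    (s : ℕ) :
    interMoment C s =
      ∑ r ∈ range (s + 1), (-1) ^ r * (k - r).choose (s - r) * diffMoment C r := by
  simp only [diffMoment, interMoment, mul_sum]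
  rw [sum_comm (s := range _)]
  refine sum_congr rfl fun b hb => ?_
  rw [sum_comm (s := range _)]
  refine sum_congr rfl fun c hc => ?_
  have h : (b ∩ c).card = k - (b \ c).card := by
    have := card_sdiff_add_card_inter b c
    rw [hC b hb] at this
    omega
  rw [h, ← sum_neg_one_pow_choose_mul_choose _ _ _
    (by rw [← hC b hb]; exact card_le_card sdiff_subset)]
  exact sum_congr rfl fun s _ => by ring

/-- The transform between the two families of moments, evaluated at the moments of a design; it is
applied with `a = k` and with `a = n - k`. -/
theorem sum_design_moment (n k a r : ℕ) (hr : r ≤ k) (hk : k ≤ n) (ha : a ≤ n) (M : ℝ) :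
    ∑ s ∈ range (r + 1), (-1 : ℝ) ^ s * (k - s).choose (r - s) *
        (M * (k.choose s * a.choose s) / n.choose s) =
      M * (k.choose r * (n - a).choose r) / n.choose r := by
  have h := sum_neg_one_pow_choose_mul_choose_div r a n (hr.trans hk) ha
  rw [mul_div_assoc, mul_div_assoc, ← h, mul_sum, mul_sum]
  refine sum_congr rfl fun s hs => ?_
  have hs : s ≤ r := by simpa [Nat.lt_succ_iff] using hs
  have key : (k.choose r : ℝ) * r.choose s = k.choose s * (k - s).choose (r - s) := by
    exact_mod_cast Nat.choose_mul hs
  linear_combination (-(M * (-1) ^ s * a.choose s / n.choose s)) * key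

/-- Being a `t`-design, in terms of the moments of `|b \ c|`. -/
theorem isTDesign_iff_diffMoment {n k t : ℕ} {C : Finset (Finset (Fin n))} (ht : 1 ≤ t)
    (htk : t ≤ k) (hkn : k ≤ n) (hC : ∀ b ∈ C, b.card = k) :
    IsTDesign n t k C ↔ ∀ r ≤ t, diffMoment C r =
      (C.card : ℝ) ^ 2 * (k.choose r * (n - k).choose r) / n.choose r := by
  have hdef : IsTDesign n t k C ↔
      ∃ lam : ℕ, ∀ T : Finset (Fin n), T.card = t → blockCount C T = lam :=
    ⟨fun ⟨lam, h⟩ => ⟨lam, h.card_containing⟩, fun ⟨lam, h⟩ => ⟨lam, ht, htk, hkn, hC, h⟩⟩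
  rw [hdef]
  constructor
  · intro h r hr
    rw [diffMoment_eq_sum hC, ← sum_design_moment n k k r (hr.trans htk) hkn hkn]
    refine sum_congr rfl fun s hs => ?_
    have hs : s ≤ r := by simpa [Nat.lt_succ_iff] using hs
    rw [(exists_blockCount_eq_iff hC (by omega)).mp
      (exists_blockCount_eq_of_le hC (hs.trans hr) htk h)]
    ring
  · intro h
    rw [exists_blockCount_eq_iff hC (htk.trans hkn), interMoment_eq_sum hC,
      sum_congr rfl fun r hr => by
        rw [h r (by simpa [Nat.lt_succ_iff] using hr)],
      sum_design_moment n k (n - k) t htk hkn (Nat.sub_le n k), Nat.sub_sub_self hkn]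
    ring

end SpectralDesign

theorem mainTheorem11 (n k t : ℕ) (ht : 1 ≤ t) (htk : t ≤ k) (htn : t + k ≤ n)
    (C : Finset (Finset (Fin n))) (hC : ∀ b ∈ C, b.card = k) :
    SpectralDesign.IsTDesign n t k C ↔
      ∀ i : ℕ, 1 ≤ i → i ≤ t →
        ∑ w : Fin n → ZMod 2,
          SpectralDesign.walsh (SpectralDesign.charFun C) w ^ 2 *
            ∑ j ∈ Finset.range (min k (n - k) + 1),
              SpectralDesign.multiplicity n i / SpectralDesign.valency n k j *
                SpectralDesign.eberlein n k j i *
                SpectralDesign.krawtchouk n (2 * j) (SpectralDesign.wt w) = 0 := by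
  open SpectralDesign Finset in
  have hspec : ∀ i : ℕ, i ≤ t →
      ((∑ w : Fin n → ZMod 2, walsh (charFun C) w ^ 2 *
        ∑ j ∈ range (min k (n - k) + 1), SpectralDesign.multiplicity n i / valency n k j *
          eberlein n k j i * krawtchouk n (2 * j) (wt w) = 0) ↔
      ∑ r ∈ range (i + 1), hahnCoeff i (k - i) (n - k - i) r * diffMoment C r = 0) := by
    intro i hit
    have hmu : SpectralDesign.multiplicity n i ≠ 0 := by
      have h1 : (0 : ℝ) < (n : ℝ) - 2 * i + 1 := by
        have : (2 * i : ℝ) ≤ n := by exact_mod_cast (by omega : 2 * i ≤ n)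
        linarith
      have h2 : (0 : ℝ) < (n : ℝ) - i + 1 := by
        have : (0 : ℝ) ≤ i := by positivity
        linarith
      have h3 : (0 : ℝ) < n.choose i := by exact_mod_cast Nat.choose_pos (by omega)
      rw [SpectralDesign.multiplicity, binom_natCast]
      positivity
    have hpair : ∑ b ∈ C, ∑ c ∈ C, SpectralDesign.multiplicity n i / valency n k (b \ c).card *
        eberlein n k (b \ c).card i = SpectralDesign.multiplicity n i *
        ∑ r ∈ range (i + 1), hahnCoeff i (k - i) (n - k - i) r * diffMoment C r := by
      simp only [diffMoment, mul_sum]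
      rw [sum_comm (s := range _)]
      refine sum_congr rfl fun b hb => ?_
      rw [sum_comm (s := range _)]
      refine sum_congr rfl fun c hc => ?_
      have hk : (b \ c).card ≤ k := (card_le_card sdiff_subset).trans (hC b hb).le
      have hn : (b \ c).card ≤ n - k := by
        have h1 : (b \ c).card ≤ cᶜ.card := card_le_card fun i hi => by simp_all
        simpa [card_compl, hC c hc] using h1
      rw [div_mul_eq_mul_div, mul_div_assoc,
        eberlein_div_valency n k i _ (by omega) (by omega) hk (by omega), mul_sum]
    rw [sum_walsh_sq_mul_sum_krawtchouk hC
      (fun j => SpectralDesign.multiplicity n i / valency n k j * eberlein n k j i), hpair]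
    simp [hmu]
  open SpectralDesign Finset in
  rw [isTDesign_iff_diffMoment ht htk (by omega) hC]
  have hbal : ∀ i : ℕ, 1 ≤ i → i ≤ t →
      ∑ r ∈ range (i + 1), hahnCoeff i (k - i) (n - k - i) r *
        ((C.card : ℝ) ^ 2 * (k.choose r * (n - k).choose r) / n.choose r) = 0 := by
    intro i hi hit
    have h := sum_hahnCoeff_mul_eq_zero n k i hi (by omega) (by omega)
    rw [← mul_zero ((C.card : ℝ) ^ 2), ← h, mul_sum]
    exact sum_congr rfl fun r _ => by ring
  constructor
  · intro h i hi hit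
    rw [hspec i hit, ← hbal i hi hit]
    exact sum_congr rfl fun r hr => by
      rw [h r (by rw [mem_range] at hr; omega)]
  · -- the system for the moments is triangular, with nonzero diagonal
    intro h r
    induction r using Nat.strong_induction_on with
    | _ r ih =>
      intro hr
      rcases Nat.eq_zero_or_pos r with rfl | hpos
      · simp [diffMoment, sq]
      · have h1 := (hspec r hr).mp (h r hpos hr)
        have h2 := hbal r hpos hr
        rw [sum_range_succ] at h1 h2
        rw [sum_congr rfl fun s hs => by
          rw [ih s (mem_range.mp hs) (by rw [mem_range] at hs; omega)]] at h1
        exact mul_left_cancel₀ (hahnCoeff_self_ne_zero r _ _)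
          (add_left_cancel (h1.trans h2.symm))
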